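/- Let $G$ be a finite connected simple graph with at least two vertices and let $U\subseteq V(G)$ be nonempty. A nucleus of $G$ is a connected subgraph $N$ of $G$ with at least one vertex whose vertex set $V(N)$ is a vertex cover of $G$. Let $$\Delta^G_U=\{E(G)\setminus E(N) : N \text{ a nucleus of } G,\ V(N)\supseteq U\},$$ a simplicial complex whose faces are sets of edges of $G$ (the empty set being a face), and let $\tilde\chi(\Delta)=\sum_{\sigma\in\Delta}(-1)^{|\sigma|-1}$ be the reduced Euler characteristic. Let $K$ be the set of cut-vertices of $G$, let $U'=U\cup K$, and let $B_1,\dots,B_c$ be the 2-connected components (blocks) of $G$, that is, the maximal connected subgraphs of $G$ that have no cut-vertex of their own (so a cut-edge with its two endpoints is a block). Then $\tilde\chi(\Delta^G_U)=0$ if and only if $|V(B_i)\cap U'|=1$ for some $i$. Equivalently, $\tilde\chi(\Delta^G_U)\neq0$ if and only if $|V(B_i)\cap U'|\ge2$ for every $i$. -/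

import Mathlib

/-- A simplicial complex on `X`, in the convention where the empty set is always a face:
a family of finite subsets of `X` that contains `∅` and is closed under taking subsets.
(Mathlib's abstract simplicial complexes exclude the empty face, which matters for the
reduced Euler characteristic.) -/
structure FaceComplex (X : Type*) where
  /-- The faces of the complex. -/
  faces : Set (Finset X)
  empty_mem : ∅ ∈ faces
  mem_of_subset : ∀ {σ τ : Finset X}, σ ∈ faces → τ ⊆ σ → τ ∈ faces

namespace FaceComplex

/-- The dimension `|σ| - 1` of a face; in particular `∅` has dimension `-1`. -/
def dim {X : Type*} (σ : Finset X) : ℤ := (σ.card : ℤ) - 1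

/-- The reduced Euler characteristic `∑ (-1) ^ dim σ`, over all faces `σ`, including `∅`. -/
noncomputable def reducedEulerChar {X : Type*} [Finite X] (Δ : FaceComplex X) : ℤ :=
  ∑ᶠ σ ∈ Δ.faces, ((Int.negOnePow (dim σ) : ℤˣ) : ℤ)

end FaceComplex

namespace SimpleGraph

variable {V : Type*}

/-- A nucleus of `G`: a connected (hence non-empty) subgraph whose vertex set is a vertex
cover of `G`. -/
def IsNucleus (G : SimpleGraph V) (N : G.Subgraph) : Prop :=
  N.Connected ∧ G.IsVertexCover N.verts

/-- The complements `E(G) \ E(N)` of the edge sets of the nuclei `N` with `U ⊆ V(N)`. -/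
def nucleusFaces (G : SimpleGraph V) (U : Set V) : Set (Finset (Sym2 V)) :=
  {A | ∃ N : G.Subgraph, G.IsNucleus N ∧ U ⊆ N.verts ∧
    (A : Set (Sym2 V)) = G.edgeSet \ N.edgeSet}

/-- Adding edges of `G` (with their endpoints) to a nucleus gives a nucleus. -/
theorem mem_nucleusFaces_of_subset (G : SimpleGraph V) (U : Set V) {A A' : Finset (Sym2 V)}
    (hA : A ∈ G.nucleusFaces U) (hAA' : A' ⊆ A) : A' ∈ G.nucleusFaces U := by
  obtain ⟨N, ⟨hconn, hcov⟩, hU, hE⟩ := hA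
  have key : ∀ v w, N.Adj v w → s(v, w) ∉ A' := by
    intro v w h hm
    have h1 : s(v, w) ∈ (A : Set (Sym2 V)) := hAA' hm
    rw [hE] at h1
    exact h1.2 h
  let M : G.Subgraph :=
    { verts := N.verts ∪ {v | ∃ w, G.Adj v w ∧ s(v, w) ∉ A'}
      Adj := fun v w => G.Adj v w ∧ s(v, w) ∉ A'
      adj_sub := fun h => h.1
      edge_vert := fun {v w} h => Or.inr ⟨w, h⟩
      symm := ⟨fun v w h => ⟨h.1.symm, by rw [Sym2.eq_swap]; exact h.2⟩⟩ }
  have hle : N ≤ M := ⟨Set.subset_union_left, fun v w h => ⟨N.adj_sub h, key v w h⟩⟩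
  have hback : ∀ x : M.verts, ∃ y : M.verts, (y : V) ∈ N.verts ∧ M.coe.Reachable x y := by
    rintro ⟨x, hx⟩
    rcases hx with hx | ⟨w, hw⟩
    · exact ⟨⟨x, Or.inl hx⟩, hx, Reachable.refl _⟩
    · rcases hcov hw.1 with h | h
      · exact ⟨⟨x, Or.inl h⟩, h, Reachable.refl _⟩
      · exact ⟨⟨w, Or.inl h⟩, h, Adj.reachable (show M.Adj x w from hw)⟩
  refine ⟨M, ⟨⟨(connected_iff _).2 ⟨?_, ?_⟩⟩, ?_⟩, hU.trans hle.1, ?_⟩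
  · intro a b
    obtain ⟨a', ha', hra⟩ := hback a
    obtain ⟨b', hb', hrb⟩ := hback b
    have h := (hconn.coe.preconnected ⟨a', ha'⟩ ⟨b', hb'⟩).map (Subgraph.inclusion hle)
    exact hra.trans (h.trans hrb.symm)
  · obtain ⟨v, hv⟩ := hconn.nonempty
    exact ⟨⟨v, hle.1 hv⟩⟩
  · exact hcov.subset hle.1
  · ext e
    induction e using Sym2.ind with
    | _ v w =>
      constructor
      · intro h
        have h1 : s(v, w) ∈ (A : Set (Sym2 V)) := hAA' h
        rw [hE] at h1
        exact ⟨h1.1, fun h2 => (show G.Adj v w ∧ s(v, w) ∉ A' from h2).2 h⟩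
      · rintro ⟨h1, h2⟩
        by_contra h3
        exact h2 (show G.Adj v w ∧ s(v, w) ∉ A' from ⟨h1, h3⟩)

/-- The `U`-nucleus complex of a connected graph `G`: its vertices are edges of `G`, and its
faces are the sets `E(G) \ E(N)`, where `N` is a nucleus of `G` with `U ⊆ V(N)`. It is used
here only for non-empty `U`. -/
def nucleusComplex (G : SimpleGraph V) (hG : G.Connected) (U : Set V) :
    FaceComplex (Sym2 V) where
  faces := G.nucleusFaces U
  empty_mem := ⟨⊤, ⟨⟨Subgraph.topIso.connected_iff.2 hG⟩, by simp⟩, by simp, by simp⟩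
  mem_of_subset := G.mem_nucleusFaces_of_subset U

/-- `x` is a cut-vertex of `G` if deleting it increases the number of connected components. -/
def IsCutVertex (G : SimpleGraph V) (x : V) : Prop :=
  Nat.card G.ConnectedComponent < Nat.card (G.induce {x}ᶜ).ConnectedComponent

/-- The set of cut-vertices of `G`. -/
def cutVertices (G : SimpleGraph V) : Set V := {x | G.IsCutVertex x}

/-- The 2-connected components (blocks) of `G`: the subgraphs `B` of `G` that are maximal among
the connected subgraphs having no cut-vertex of their own. In particular, a cut-edge together
with its two endpoints is a block. -/
def IsBlock (G : SimpleGraph V) (B : G.Subgraph) : Prop :=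
  Maximal (fun H : G.Subgraph => H.Connected ∧ ∀ x : H.verts, ¬ H.coe.IsCutVertex x) B

end SimpleGraph

namespace SimpleGraph

variable {V : Type*}

/-! Fix u ∈ U. A nucleus containing U is the component of u in its own edge set, so up to sign the
reduced Euler characteristic is `rootedSum`, the signed count of edge sets S whose component at u
contains U and covers every edge. Splitting on whether S reaches a vertex v gives a recursion
(`rootedSum_eq_add`) in which signs alternate so that nothing cancels
(`rootedSum_sign_and_ne_zero_iff`). Acyclic orientations with unique source u and all sinks in U,
encoded by heights, obey the matching recursion, according to whether v is a sink
(`hasPotential_insert_iff`). Hence the characteristic is nonzero iff such an orientation exists.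

It remains to compare orientations with blocks. A non-cut vertex has all its neighbours in its
block, so the lowest and highest vertices of a block lie in U'; if U' met the block only once, the
heights there would be constant, which is impossible (`two_le_ncard_block_inter`). Conversely, grow
an orientation from u by ears: paths that end in U or return to a higher vertex. If a maximal one
misses a vertex, some component of the rest avoids U and hangs on a single vertex
(`hasPotential_or_exists_block`), and inside it sits a block meeting U' exactly once
(`exists_block_of_attached`). -/

theorem Reachable.iff_of_forall_adj {H : SimpleGraph V} {a b : V} (h : H.Reachable a b)
    {f : V → Prop} (hf : ∀ x y, H.Adj x y → (f x ↔ f y)) : f a ↔ f b := by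
  obtain ⟨p⟩ := h
  induction p with
  | nil => rfl
  | cons h _ ih => exact (hf _ _ h).trans ih

/-- A graph is preconnected iff every property that is invariant along edges is constant. -/
theorem preconnected_iff_forall_prop {H : SimpleGraph V} :
    H.Preconnected ↔
      ∀ f : V → Prop, (∀ x y, H.Adj x y → (f x ↔ f y)) → ∀ a b, f a → f b := by
  refine ⟨fun h f hf a b ha => ((h a b).iff_of_forall_adj hf).1 ha, fun h a b => ?_⟩
  exact h (fun x => H.Reachable a x)
    (fun x y hxy => ⟨fun hx => hx.trans hxy.reachable, fun hy => hy.trans hxy.symm.reachable⟩)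
    a b (Reachable.refl _)

/-! ### Signed counts of rooted edge sets, and height functions -/

/-- `v` is reachable from `u` along edges in `S`. -/
def EdgeReach (u : V) (S : Finset (Sym2 V)) (v : V) : Prop :=
  (fromEdgeSet (S : Set (Sym2 V))).Reachable u v

theorem EdgeReach.refl (u : V) (S : Finset (Sym2 V)) : EdgeReach u S u := Reachable.refl _

theorem EdgeReach.step {u : V} {S : Finset (Sym2 V)} {a b : V} (h : EdgeReach u S a)
    (hab : s(a, b) ∈ S) : EdgeReach u S b := by
  by_cases hne : a = b
  · exact hne ▸ h
  · exact Reachable.trans h (Adj.reachable ((fromEdgeSet_adj _).2 ⟨hab, hne⟩))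

theorem EdgeReach.induction {u : V} {S : Finset (Sym2 V)} {P : V → Prop} (h0 : P u)
    (hs : ∀ a b, EdgeReach u S a → P a → s(a, b) ∈ S → P b) {v : V} (h : EdgeReach u S v) :
    P v := by
  have h' := (reachable_iff_reflTransGen _ _).1 h
  induction h' with
  | refl => exact h0
  | tail hab hbc ih =>
    have hr := (reachable_iff_reflTransGen _ _).2 hab
    exact hs _ _ hr (ih hr) ((fromEdgeSet_adj _).1 hbc).1

/-- Only edges touching the component of u determine it, so edges away from it may be toggled
freely. -/
theorem edgeReach_congr {u : V} {S S' : Finset (Sym2 V)}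
    (h : ∀ x y, EdgeReach u S x → (s(x, y) ∈ S ↔ s(x, y) ∈ S')) :
    EdgeReach u S = EdgeReach u S' := by
  funext v
  refine propext ⟨fun hv => ?_, fun hv => ?_⟩
  · exact EdgeReach.induction (EdgeReach.refl u S')
      (fun a b ha ha' hab => ha'.step ((h a b ha).1 hab)) hv
  · exact EdgeReach.induction (EdgeReach.refl u S)
      (fun a b _ ha' hab => ha'.step ((h a b ha').2 hab)) hv

theorem not_edgeReach_of_forall_notMem {u v : V} (huv : v ≠ u) {S : Finset (Sym2 V)}
    (h : ∀ a, s(a, v) ∉ S) : ¬ EdgeReach u S v := by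
  intro hv
  have : ∀ w, EdgeReach u S w → w ≠ v := fun w hw =>
    EdgeReach.induction (P := fun w => w ≠ v) huv.symm
      (fun a b _ _ hab hb => h a (hb ▸ hab)) hw
  exact this v hv rfl

/-- The component of `u` under the edges `S` contains `U` and covers all edges of `G[W]`. -/
def RootedCover (G : SimpleGraph V) (u : V) (W U : Finset V) (S : Finset (Sym2 V)) : Prop :=
  (∀ v ∈ U, EdgeReach u S v) ∧
    ∀ a ∈ W, ∀ b ∈ W, G.Adj a b → EdgeReach u S a ∨ EdgeReach u S b

/-- There is a height function on `W` such that each vertex but `u` has a lower neighbour and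
each vertex outside `U` has a higher neighbour, i.e. an acyclic orientation of `G[W]` with
unique source `u` and all sinks in `U`. -/
def HasPotential (G : SimpleGraph V) (u : V) (W U : Finset V) : Prop :=
  ∃ h : V → ℚ, (∀ v ∈ W, v ≠ u → ∃ w ∈ W, G.Adj v w ∧ h w < h v) ∧
    ∀ v ∈ W, v ∉ U → ∃ w ∈ W, G.Adj v w ∧ h v < h w

/-- Both the lowest and the highest vertex must be u, so h is constant and no other vertex has a
lower neighbour. -/
theorem not_hasPotential_singleton {G : SimpleGraph V} {u : V} {W : Finset V} (hu : u ∈ W)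
    (hW : W ≠ {u}) : ¬ G.HasPotential u W {u} := by
  rintro ⟨h, hlow, hup⟩
  obtain ⟨v, hv, hvu⟩ : ∃ v ∈ W, v ≠ u := by
    by_contra! hne
    exact hW (Finset.eq_singleton_iff_unique_mem.2 ⟨hu, hne⟩)
  obtain ⟨m, hm, hmin⟩ := Finset.exists_min_image W h ⟨u, hu⟩
  obtain ⟨M, hM, hmax⟩ := Finset.exists_max_image W h ⟨u, hu⟩
  have hmu : m = u := by
    by_contra hne
    obtain ⟨w, hw, -, hlt⟩ := hlow m hm hne
    exact absurd (hmin w hw) (not_le.2 hlt)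
  have hMu : M = u := by
    by_contra hne
    obtain ⟨w, hw, -, hlt⟩ := hup M hM (by simpa using hne)
    exact absurd (hmax w hw) (not_le.2 hlt)
  subst hmu
  subst hMu
  obtain ⟨w, hw, -, hlt⟩ := hlow v hv hvu
  linarith [hmin w hw, hmax v hv]

section Sum

variable [Fintype V] [DecidableEq V]

open Classical in
/-- The edges of `G` with both endpoints in `W`. -/
noncomputable def edgesWithin (G : SimpleGraph V) (W : Finset V) : Finset (Sym2 V) :=
  Finset.univ.filter fun e => e ∈ G.edgeSet ∧ ∀ v ∈ e, v ∈ W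

theorem mk_mem_edgesWithin {G : SimpleGraph V} {W : Finset V} {a b : V} :
    s(a, b) ∈ G.edgesWithin W ↔ G.Adj a b ∧ a ∈ W ∧ b ∈ W := by
  simp [edgesWithin]

open Classical in
/-- The signed number of edge sets in `G[W]` that satisfy `RootedCover`. -/
noncomputable def rootedSum (G : SimpleGraph V) (u : V) (W U : Finset V) : ℤ :=
  ∑ S ∈ (G.edgesWithin W).powerset with G.RootedCover u W U S, (-1) ^ S.card

open Classical in
theorem rootedSum_eq_zero_of_isolated {G : SimpleGraph V} {u v : V} {W U : Finset V}
    (hvu : v ≠ u) (hvU : v ∈ U) (hv : ∀ w ∈ W, ¬ G.Adj v w) : G.rootedSum u W U = 0 := by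
  unfold rootedSum
  refine Finset.sum_eq_zero fun S hS => ?_
  rw [Finset.mem_filter, Finset.mem_powerset] at hS
  refine absurd (hS.2.1 v hvU) (not_edgeReach_of_forall_notMem hvu fun a ha => ?_)
  obtain ⟨h1, h2, -⟩ := mk_mem_edgesWithin.1 (hS.1 ha)
  exact hv a h2 h1.symm

-- Split on whether S reaches v. If it does not, covering forces every neighbour of v to be reached
-- and S to have no edge at v, so S lives on `W.erase v`.
open Classical in
theorem rootedSum_eq_add {G : SimpleGraph V} {u v : V} {W U : Finset V} (hvu : v ≠ u)
    (hvW : v ∈ W) :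
    G.rootedSum u W U = G.rootedSum u W (insert v U) +
      G.rootedSum u (W.erase v) (U ∪ W.filter (G.Adj v)) := by
  unfold rootedSum
  rw [← Finset.sum_filter_add_sum_filter_not ((G.edgesWithin W).powerset.filter _)
    (fun S => EdgeReach u S v), Finset.filter_filter, Finset.filter_filter]
  congr 1
  · refine Finset.sum_congr (Finset.filter_congr fun S _ => ?_) fun _ _ => rfl
    simp only [RootedCover, Finset.forall_mem_insert]
    tauto
  · refine Finset.sum_congr (Finset.ext fun S => ?_) fun _ _ => rfl
    simp only [Finset.mem_filter, Finset.mem_powerset]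
    constructor
    · rintro ⟨hS, ⟨hU, hc⟩, hv⟩
      have key : ∀ b, s(v, b) ∉ S := by
        intro b hb
        obtain ⟨h1, h2, h3⟩ := mk_mem_edgesWithin.1 (hS hb)
        rcases hc v h2 b h3 h1 with h | h
        · exact hv h
        · exact hv (h.step (by rwa [Sym2.eq_swap]))
      refine ⟨fun e he => ?_, fun x hx => ?_, fun a ha b hb => ?_⟩
      · induction e using Sym2.ind with
        | _ a b =>
          obtain ⟨h1, h2, h3⟩ := mk_mem_edgesWithin.1 (hS he)
          refine mk_mem_edgesWithin.2 ⟨h1, Finset.mem_erase.2 ⟨?_, h2⟩,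
            Finset.mem_erase.2 ⟨?_, h3⟩⟩
          · rintro rfl
            exact key _ he
          · rintro rfl
            exact key a (by rwa [Sym2.eq_swap])
      · rcases Finset.mem_union.1 hx with hx | hx
        · exact hU x hx
        · obtain ⟨h1, h2⟩ := Finset.mem_filter.1 hx
          exact (hc v hvW x h1 h2).resolve_left hv
      · exact hc a (Finset.mem_of_mem_erase ha) b (Finset.mem_of_mem_erase hb)
    · rintro ⟨hS, hU, hc⟩
      have hv : ¬ EdgeReach u S v := not_edgeReach_of_forall_notMem hvu fun a ha =>
        (Finset.notMem_erase v W) (mk_mem_edgesWithin.1 (hS ha)).2.2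
      have hN : ∀ x ∈ W, G.Adj v x → EdgeReach u S x := fun x hx h =>
        hU x (Finset.mem_union_right _ (Finset.mem_filter.2 ⟨hx, h⟩))
      refine ⟨fun e he => ?_, ⟨fun x hx => hU x (Finset.mem_union_left _ hx),
        fun a ha b hb hab => ?_⟩, hv⟩
      · induction e using Sym2.ind with
        | _ a b =>
          obtain ⟨h1, h2, h3⟩ := mk_mem_edgesWithin.1 (hS he)
          exact mk_mem_edgesWithin.2
            ⟨h1, Finset.mem_of_mem_erase h2, Finset.mem_of_mem_erase h3⟩
      · by_cases hav : a = v
        · exact Or.inr (hN b hb (hav ▸ hab))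
        · by_cases hbv : b = v
          · exact Or.inl (hN a ha (hbv ▸ hab.symm))
          · exact hc a (Finset.mem_erase.2 ⟨hav, ha⟩) b (Finset.mem_erase.2 ⟨hbv, hb⟩) hab

open Classical in
/-- Toggling an edge that depends only on the component of `u`, and misses it, cancels the
edge sets whose component does not cover `G[W]`. -/
theorem rootedSum_singleton_eq_zero {G : SimpleGraph V} {u : V} {W : Finset V}
    (hW : (G.edgesWithin W).Nonempty) : G.rootedSum u W {u} = 0 := by
  have htot : ∑ S ∈ (G.edgesWithin W).powerset, (-1 : ℤ) ^ S.card = 0 :=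
    Finset.sum_powerset_neg_one_pow_card_of_nonempty hW
  rw [← Finset.sum_filter_add_sum_filter_not _ (fun S => G.RootedCover u W {u} S)] at htot
  unfold rootedSum
  suffices h : ∑ S ∈ (G.edgesWithin W).powerset with ¬ G.RootedCover u W {u} S,
      (-1 : ℤ) ^ S.card = 0 by
    rwa [h, add_zero] at htot
  -- The edge is chosen as a function of the component alone, so toggling it, which preserves the
  -- component, leads to the same choice again. When no edge is missed, `s(u, u)` is a dummy value.
  have hpick : ∀ R : V → Prop, ∃ e : Sym2 V,
      (∃ e' ∈ G.edgesWithin W, ∀ v ∈ e', ¬ R v) → e ∈ G.edgesWithin W ∧ ∀ v ∈ e, ¬ R v := by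
    intro R
    by_cases h : ∃ e' ∈ G.edgesWithin W, ∀ v ∈ e', ¬ R v
    · obtain ⟨e, he⟩ := h
      exact ⟨e, fun _ => he⟩
    · exact ⟨s(u, u), fun h' => absurd h' h⟩
  choose pick hpick using hpick
  have hbad : ∀ S : Finset (Sym2 V), ¬ G.RootedCover u W {u} S ↔
      ∃ e' ∈ G.edgesWithin W, ∀ v ∈ e', ¬ EdgeReach u S v := by
    intro S
    constructor
    · intro h
      by_contra hne
      refine h ⟨fun v hv => (Finset.mem_singleton.1 hv) ▸ EdgeReach.refl u S,
        fun a ha b hb hab => ?_⟩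
      by_contra! hr
      refine hne ⟨s(a, b), mk_mem_edgesWithin.2 ⟨hab, ha, hb⟩, fun v hv => ?_⟩
      rcases Sym2.mem_iff.1 hv with rfl | rfl
      exacts [hr.1, hr.2]
    · rintro ⟨e, he, hr⟩ ⟨-, hc⟩
      induction e using Sym2.ind with
      | _ a b =>
        obtain ⟨h1, h2, h3⟩ := mk_mem_edgesWithin.1 he
        rcases hc a h2 b h3 h1 with h | h
        · exact hr a (Sym2.mem_mk_left a b) h
        · exact hr b (Sym2.mem_mk_right a b) h
  let toggle : Finset (Sym2 V) → Finset (Sym2 V) := fun S => symmDiff S {pick (EdgeReach u S)}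
  have hreach : ∀ S, ¬ G.RootedCover u W {u} S → EdgeReach u (toggle S) = EdgeReach u S := by
    intro S hS
    refine (edgeReach_congr fun x y hx => ?_).symm
    have hp := (hpick _ ((hbad S).1 hS)).2
    have hne : s(x, y) ≠ pick (EdgeReach u S) := fun h =>
      hp x (h ▸ Sym2.mem_mk_left x y) hx
    simp [toggle, Finset.mem_symmDiff, hne]
  refine Finset.sum_involution (fun S _ => toggle S) ?_ ?_ ?_ ?_
  · intro S _
    by_cases he : pick (EdgeReach u S) ∈ S
    · have : toggle S = S.erase (pick (EdgeReach u S)) := by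
        ext e
        simp only [toggle, Finset.mem_symmDiff, Finset.mem_singleton, Finset.mem_erase]
        grind
      rw [this, ← Finset.card_erase_add_one he, pow_succ]
      ring
    · have : toggle S = insert (pick (EdgeReach u S)) S := by
        ext e
        simp only [toggle, Finset.mem_symmDiff, Finset.mem_singleton, Finset.mem_insert]
        grind
      rw [this, Finset.card_insert_of_notMem he, pow_succ]
      ring
  · intro S _ _ h
    have : pick (EdgeReach u S) ∈ toggle S ↔ pick (EdgeReach u S) ∈ S := by rw [h]
    simp only [toggle, Finset.mem_symmDiff, Finset.mem_singleton] at this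
    tauto
  · intro S hS
    rw [Finset.mem_filter, Finset.mem_powerset] at hS ⊢
    refine ⟨fun e he => ?_, ?_⟩
    · simp only [toggle, Finset.mem_symmDiff, Finset.mem_singleton] at he
      rcases he with ⟨h, -⟩ | ⟨rfl, -⟩
      · exact hS.1 h
      · exact (hpick _ ((hbad S).1 hS.2)).1
    · rw [hbad, hreach S hS.2, ← hbad]
      exact hS.2
  · intro S hS
    rw [Finset.mem_filter] at hS
    change symmDiff (toggle S) {pick (EdgeReach u (toggle S))} = S
    rw [hreach S hS.2, symmDiff_symmDiff_cancel_right]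

-- Either v has a higher neighbour, and then need not be allowed as a sink, or v is a sink and can
-- be deleted; only its neighbours can thereby lose their last higher neighbour. Conversely, v is
-- put back above everything, and `hv` supplies its lower neighbour.
open Classical in
theorem hasPotential_insert_iff {G : SimpleGraph V} {u v : V} {W U : Finset V}
    (hvu : v ≠ u) (hvW : v ∈ W) (hv : ∃ w ∈ W, G.Adj v w) :
    G.HasPotential u W (insert v U) ↔
      G.HasPotential u W U ∨
        G.HasPotential u (W.erase v) (U ∪ W.filter (G.Adj v)) := by
  constructor
  · rintro ⟨h, hlow, hup⟩
    by_cases hsink : ∃ w ∈ W, G.Adj v w ∧ h v < h w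
    · refine Or.inl ⟨h, hlow, fun x hx hxU => ?_⟩
      by_cases hxv : x = v
      · exact hxv ▸ hsink
      · exact hup x hx (by simp [hxv, hxU])
    · push Not at hsink
      refine Or.inr ⟨h, fun x hx hxu => ?_, fun x hx hxU => ?_⟩
      · obtain ⟨w, hw, hadj, hlt⟩ := hlow x (Finset.mem_of_mem_erase hx) hxu
        refine ⟨w, Finset.mem_erase.2 ⟨?_, hw⟩, hadj, hlt⟩
        rintro rfl
        exact absurd (hsink x (Finset.mem_of_mem_erase hx) hadj.symm) (not_le.2 hlt)
      · obtain ⟨hxv, hxW⟩ := Finset.mem_erase.1 hx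
        simp only [Finset.mem_union, Finset.mem_filter, not_or, not_and] at hxU
        obtain ⟨w, hw, hadj, hlt⟩ := hup x hxW (by simp [hxv, hxU.1])
        refine ⟨w, Finset.mem_erase.2 ⟨?_, hw⟩, hadj, hlt⟩
        rintro rfl
        exact hxU.2 hxW hadj.symm
  · rintro (⟨h, hlow, hup⟩ | ⟨h, hlow, hup⟩)
    · exact ⟨h, hlow, fun x hx hxU => hup x hx fun hx' => hxU (Finset.mem_insert_of_mem hx')⟩
    · obtain ⟨M, hM⟩ : ∃ M : ℚ, ∀ x : V, h x < M := by
        obtain ⟨y, -, hy⟩ := Finset.exists_max_image Finset.univ h ⟨u, Finset.mem_univ u⟩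
        exact ⟨h y + 1, fun x => by linarith [hy x (Finset.mem_univ x)]⟩
      refine ⟨Function.update h v M, fun x hx hxu => ?_, fun x hx hxU => ?_⟩
      · by_cases hxv : x = v
        · subst hxv
          obtain ⟨w, hw, hadj⟩ := hv
          refine ⟨w, hw, hadj, ?_⟩
          simpa [Function.update_of_ne hadj.ne'] using hM w
        · obtain ⟨w, hw, hadj, hlt⟩ := hlow x (Finset.mem_erase.2 ⟨hxv, hx⟩) hxu
          obtain ⟨hwv, hwW⟩ := Finset.mem_erase.1 hw
          exact ⟨w, hwW, hadj, by simpa [Function.update_of_ne hxv, Function.update_of_ne hwv]⟩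
      · simp only [Finset.mem_insert, not_or] at hxU
        obtain ⟨hxv, hxU⟩ := hxU
        by_cases hadj : G.Adj v x
        · exact ⟨v, hvW, hadj.symm, by simpa [Function.update_of_ne hxv] using hM x⟩
        · obtain ⟨w, hw, hxw, hlt⟩ := hup x (Finset.mem_erase.2 ⟨hxv, hx⟩)
            (by simp [hxU, hadj])
          obtain ⟨hwv, hwW⟩ := Finset.mem_erase.1 hw
          exact ⟨w, hwW, hxw, by simpa [Function.update_of_ne hxv, Function.update_of_ne hwv]⟩

-- Sign and nonvanishing are proved together, since the sign is what excludes cancellation. The last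
-- hypothesis is needed because an isolated vertex outside U flips the expected sign without
-- changing the sum; it survives deleting v because the neighbours of v join U.
open Classical in
theorem rootedSum_sign_and_ne_zero_iff {G : SimpleGraph V} {u : V} :
    ∀ (n k : ℕ) (W U : Finset V), W.card = n → U.card = k → u ∈ U → U ⊆ W →
      (∀ v ∈ W, v ∉ U → ∃ w ∈ W, G.Adj v w) →
      0 ≤ (-1) ^ (W.card + 1) * G.rootedSum u W U ∧
        (G.rootedSum u W U ≠ 0 ↔ G.HasPotential u W U) := by
  intro n
  induction n with
  | zero =>
    intro k W U hW _ hu hUW _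
    rw [Finset.card_eq_zero] at hW
    exact absurd (hUW hu) (by simp [hW])
  | succ n ihn =>
    intro k
    induction k with
    | zero =>
      intro W U _ hU hu _ _
      rw [Finset.card_eq_zero] at hU
      exact absurd hu (by simp [hU])
    | succ k ihk =>
      intro W U hW hU hu hUW hiso
      by_cases h1 : ∃ v ∈ W, v ≠ u ∧ ∀ w ∈ W, ¬ G.Adj v w
      · obtain ⟨v, hvW, hvu, hv⟩ := h1
        have hvU : v ∈ U := by
          by_contra hvU
          obtain ⟨w, hw, hadj⟩ := hiso v hvW hvU
          exact hv w hw hadj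
        rw [rootedSum_eq_zero_of_isolated hvu hvU hv]
        refine ⟨by simp, by simp, ?_⟩
        rintro ⟨h, hlow, -⟩
        obtain ⟨w, hw, hadj, -⟩ := hlow v hvW hvu
        exact absurd hadj (hv w hw)
      · push Not at h1
        by_cases h2 : ∃ v ∈ U, v ≠ u
        · obtain ⟨v, hvU, hvu⟩ := h2
          have hvW := hUW hvU
          have huE : u ∈ U.erase v := Finset.mem_erase.2 ⟨hvu.symm, hu⟩
          -- The recursion is read backwards: the sum for U is a difference of one with smaller U
          -- and one with smaller W.
          have hrec := rootedSum_eq_add (G := G) (U := U.erase v) hvu hvW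
          have hpot := hasPotential_insert_iff (U := U.erase v) hvu hvW (h1 v hvW hvu)
          rw [Finset.insert_erase hvU] at hrec hpot
          have hcW : (W.erase v).card + 1 = W.card := Finset.card_erase_add_one hvW
          have hcU : (U.erase v).card + 1 = U.card := Finset.card_erase_add_one hvU
          obtain ⟨a1, a2⟩ := ihk W (U.erase v) hW (by omega) huE
            ((Finset.erase_subset _ _).trans hUW) (fun x hx hxU =>
              h1 x hx (fun h => hxU (h ▸ huE)))
          obtain ⟨b1, b2⟩ := ihn _ (W.erase v) (U.erase v ∪ W.filter (G.Adj v)) (by omega) rfl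
            (Finset.mem_union_left _ huE) (by
              intro x hx
              rcases Finset.mem_union.1 hx with hx | hx
              · obtain ⟨hxv, hxU⟩ := Finset.mem_erase.1 hx
                exact Finset.mem_erase.2 ⟨hxv, hUW hxU⟩
              · obtain ⟨hxW, hadj⟩ := Finset.mem_filter.1 hx
                exact Finset.mem_erase.2 ⟨hadj.ne', hxW⟩) (by
              intro x hx hxU
              obtain ⟨hxv, hxW⟩ := Finset.mem_erase.1 hx
              simp only [Finset.mem_union, Finset.mem_filter, not_or, not_and] at hxU
              obtain ⟨w, hw, hadj⟩ := h1 x hxW (fun h => hxU.1 (h ▸ huE))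
              refine ⟨w, Finset.mem_erase.2 ⟨?_, hw⟩, hadj⟩
              rintro rfl
              exact hxU.2 hxW hadj.symm)
          set A := G.rootedSum u W (U.erase v)
          set B := G.rootedSum u (W.erase v) (U.erase v ∪ W.filter (G.Adj v))
          have hT : G.rootedSum u W U = A - B := by linarith
          rw [hpot, ← a2, ← b2, hT, ← hcW]
          rw [← hcW] at a1
          -- A and B have weakly opposite signs, so A - B vanishes only if both do.
          rcases neg_one_pow_eq_or ℤ ((W.erase v).card + 1) with he | he
          · rw [pow_succ, he] at a1 ⊢
            rw [he] at b1
            refine ⟨by linarith, ?_⟩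
            constructor
            · intro h
              by_contra! hc
              exact h (by rw [hc.1, hc.2, sub_zero])
            · rintro (h | h) h' <;> apply h <;> linarith
          · rw [pow_succ, he] at a1 ⊢
            rw [he] at b1
            refine ⟨by linarith, ?_⟩
            constructor
            · intro h
              by_contra! hc
              exact h (by rw [hc.1, hc.2, sub_zero])
            · rintro (h | h) h' <;> apply h <;> linarith
        · push Not at h2
          obtain rfl : U = {u} := Finset.eq_singleton_iff_unique_mem.2 ⟨hu, h2⟩
          by_cases hWu : W = {u}
          · subst hWu
            have hE : G.edgesWithin {u} = ∅ := by
              ext e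
              induction e using Sym2.ind with
              | _ a b =>
                simp only [mk_mem_edgesWithin, Finset.mem_singleton, Finset.notMem_empty,
                  iff_false]
                rintro ⟨h, rfl, rfl⟩
                exact G.irrefl h
            have hT : G.rootedSum u {u} {u} = 1 := by
              unfold rootedSum
              rw [hE, Finset.powerset_empty, Finset.filter_singleton, if_pos]
              · simp
              · simp [RootedCover, EdgeReach.refl]
            rw [hT]
            exact ⟨by simp, fun _ => ⟨fun _ => 0, by simp, by simp⟩, fun _ => one_ne_zero⟩
          · obtain ⟨v, hv, hvu⟩ : ∃ v ∈ W, v ≠ u := by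
              by_contra! hne
              exact hWu (Finset.eq_singleton_iff_unique_mem.2 ⟨hUW hu, hne⟩)
            obtain ⟨w, hw, hadj⟩ := h1 v hv hvu
            rw [rootedSum_singleton_eq_zero ⟨s(v, w), mk_mem_edgesWithin.2 ⟨hadj, hv, hw⟩⟩]
            exact ⟨by simp, by simp, fun h => absurd h (not_hasPotential_singleton (hUW hu) hWu)⟩

end Sum

/-! ### From nuclei to rooted edge sets -/

theorem mem_edgesWithin_univ [Fintype V] [DecidableEq V] {G : SimpleGraph V} {e : Sym2 V} :
    e ∈ G.edgesWithin Finset.univ ↔ e ∈ G.edgeSet := by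
  simp [edgesWithin]

/-- The component of `u` in a set of edges, all of which it contains, as a subgraph. -/
def rootedSubgraph (G : SimpleGraph V) (u : V) (S : Finset (Sym2 V))
    (hSG : (S : Set (Sym2 V)) ⊆ G.edgeSet)
    (hS : ∀ a b, s(a, b) ∈ S → EdgeReach u S a) : G.Subgraph where
  verts := {v | EdgeReach u S v}
  Adj a b := s(a, b) ∈ S
  adj_sub h := hSG h
  edge_vert h := hS _ _ h
  symm := ⟨fun a b h => by rwa [Sym2.eq_swap]⟩

theorem rootedSubgraph_connected {G : SimpleGraph V} {u : V} {S : Finset (Sym2 V)}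
    (hSG : (S : Set (Sym2 V)) ⊆ G.edgeSet) (hS : ∀ a b, s(a, b) ∈ S → EdgeReach u S a) :
    (G.rootedSubgraph u S hSG hS).Connected := by
  refine ⟨(connected_iff _).2 ⟨?_, ⟨⟨u, EdgeReach.refl u S⟩⟩⟩⟩
  rw [preconnected_iff_forall_prop]
  intro f hf
  have key : ∀ v (hv : EdgeReach u S v),
      (f ⟨u, EdgeReach.refl u S⟩ ↔ f ⟨v, hv⟩) := by
    intro v hv
    have := EdgeReach.induction (u := u) (S := S)
      (P := fun v => ∀ hv : EdgeReach u S v, (f ⟨u, EdgeReach.refl u S⟩ ↔ f ⟨v, hv⟩))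
      (fun _ => Iff.rfl)
      (fun a b ha ih hab hb => (ih ha).trans (hf ⟨a, ha⟩ ⟨b, hb⟩ hab)) hv
    exact this hv
  rintro ⟨a, ha⟩ ⟨b, hb⟩ h
  exact (key b hb).1 ((key a ha).2 h)

/-- Connectedness makes u reach all of N along E(N). Conversely, covering puts every edge of S in
the component of u, so that component is a nucleus with edge set exactly S. -/
theorem mem_nucleusFaces_iff [Fintype V] [DecidableEq V] {G : SimpleGraph V} {u : V}
    {U : Finset V} (hu : u ∈ U) {A : Finset (Sym2 V)} :
    A ∈ G.nucleusFaces U ↔ ∃ S, (S ⊆ G.edgesWithin Finset.univ ∧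
      G.RootedCover u Finset.univ U S) ∧ G.edgesWithin Finset.univ \ S = A := by
  constructor
  · rintro ⟨N, ⟨hconn, hcov⟩, hUN, hA⟩
    have hAE : A ⊆ G.edgesWithin Finset.univ := by
      intro e he
      rw [← Finset.mem_coe, hA] at he
      exact mem_edgesWithin_univ.2 he.1
    have hr : ∀ v ∈ N.verts, EdgeReach u (G.edgesWithin Finset.univ \ A) v := by
      intro v hv
      have h := hconn.coe.preconnected ⟨u, hUN hu⟩ ⟨v, hv⟩
      refine (h.iff_of_forall_adj (f := fun x =>
        EdgeReach u (G.edgesWithin Finset.univ \ A) x) fun x y hxy => ?_).1 (EdgeReach.refl _ _)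
      have hxy' : N.Adj x y := hxy
      have hmem : s((x : V), (y : V)) ∈ G.edgesWithin Finset.univ \ A := by
        refine Finset.mem_sdiff.2 ⟨mem_edgesWithin_univ.2 hxy'.adj_sub, fun h => ?_⟩
        rw [← Finset.mem_coe, hA] at h
        exact h.2 hxy'
      exact ⟨fun hx => hx.step hmem, fun hy => hy.step (by rwa [Sym2.eq_swap])⟩
    refine ⟨G.edgesWithin Finset.univ \ A, ⟨Finset.sdiff_subset, fun v hv => hr v (hUN hv),
      fun a _ b _ hab => ?_⟩, Finset.sdiff_sdiff_eq_self hAE⟩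
    exact (hcov hab).imp (hr a) (hr b)
  · rintro ⟨S, ⟨hSE, hU, hc⟩, rfl⟩
    have hSG : (S : Set (Sym2 V)) ⊆ G.edgeSet := fun e he => mem_edgesWithin_univ.1 (hSE he)
    have hS : ∀ a b, s(a, b) ∈ S → EdgeReach u S a := by
      intro a b hab
      refine (hc a (Finset.mem_univ a) b (Finset.mem_univ b) (hSG hab)).elim id fun h =>
        h.step (by rwa [Sym2.eq_swap])
    refine ⟨G.rootedSubgraph u S hSG hS, ⟨rootedSubgraph_connected hSG hS, fun a b hab => ?_⟩,
      fun v hv => hU v hv, ?_⟩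
    · exact hc a (Finset.mem_univ a) b (Finset.mem_univ b) hab
    · ext e
      rw [Finset.mem_coe, Finset.mem_sdiff, mem_edgesWithin_univ, Set.mem_sdiff]
      refine and_congr_right fun _ => not_congr ?_
      induction e using Sym2.ind with
      | _ a b => rfl

open Classical in
theorem reducedEulerChar_nucleusComplex [Fintype V] [DecidableEq V] {G : SimpleGraph V}
    (hG : G.Connected) {u : V} {U : Finset V} (hu : u ∈ U) :
    (G.nucleusComplex hG U).reducedEulerChar =
      (-1) ^ ((G.edgesWithin Finset.univ).card + 1) * G.rootedSum u Finset.univ U := by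
  set E := G.edgesWithin Finset.univ
  set P := E.powerset.filter fun S => G.RootedCover u Finset.univ U S
  have hfaces : (G.nucleusComplex hG U).faces = (fun S => E \ S) '' (P : Set _) := by
    ext A
    refine (mem_nucleusFaces_iff hu).trans ?_
    simp only [Set.mem_image, Finset.mem_coe, P, Finset.mem_filter, Finset.mem_powerset]
    rfl
  have hinj : Set.InjOn (fun S => E \ S) (P : Set (Finset (Sym2 V))) := by
    intro S hS S' hS' h
    simp only [Finset.mem_coe, P, Finset.mem_filter, Finset.mem_powerset] at hS hS'
    rw [← Finset.sdiff_sdiff_eq_self hS.1, ← Finset.sdiff_sdiff_eq_self hS'.1]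
    exact congrArg (E \ ·) h
  unfold FaceComplex.reducedEulerChar rootedSum
  rw [hfaces, finsum_mem_image hinj, finsum_mem_coe_finset, Finset.mul_sum]
  refine Finset.sum_congr rfl fun S hS => ?_
  have hSE : S ⊆ E := Finset.mem_powerset.1 (Finset.mem_filter.1 hS).1
  have hcard : (E.card : ℤ) = (E \ S).card + S.card := by
    exact_mod_cast (Finset.card_sdiff_add_card_eq_card hSE).symm
  -- Modulo 2, |E| - |S| - 1 equals |E| + 1 + |S|; the even correction keeps the main exponent a
  -- natural number.
  have hdim : FaceComplex.dim (E \ S) = ((E.card + 1 + S.card : ℕ) : ℤ) - 2 * (S.card + 1) := by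
    unfold FaceComplex.dim
    push_cast
    linarith
  rw [hdim, Int.negOnePow_sub, Int.negOnePow_even (2 * _) (even_two_mul _), mul_one,
    ← pow_add]
  rw [Int.negOnePow_def, zpow_natCast]
  simp

/-- The reduced Euler characteristic is non-zero iff `G` has an acyclic orientation with unique
source `u` and all sinks in `U`. -/
theorem reducedEulerChar_nucleusComplex_ne_zero_iff [Fintype V] [DecidableEq V] [Nontrivial V]
    {G : SimpleGraph V} (hG : G.Connected) {u : V} {U : Finset V} (hu : u ∈ U) :
    (G.nucleusComplex hG U).reducedEulerChar ≠ 0 ↔ G.HasPotential u Finset.univ U := by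
  rw [reducedEulerChar_nucleusComplex hG hu, mul_ne_zero_iff,
    and_iff_right (pow_ne_zero _ (by norm_num))]
  refine (rootedSum_sign_and_ne_zero_iff _ _ Finset.univ U rfl rfl hu (Finset.subset_univ U)
    fun v _ _ => ?_).2
  obtain ⟨w, hw⟩ := hG.preconnected.exists_adj_of_nontrivial v
  exact ⟨w, Finset.mem_univ w, hw⟩

/-! ### Blocks as maximal nonseparable vertex sets -/

/-- Connectedness of `G[S]`: every property invariant along the edges of `G[S]` is constant. -/
def SetConnected (G : SimpleGraph V) (S : Set V) : Prop :=
  ∀ f : V → Prop, (∀ a ∈ S, ∀ b ∈ S, G.Adj a b → (f a ↔ f b)) → ∀ a ∈ S, ∀ b ∈ S, f a → f b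

/-- `G[S]` is connected and remains so after deleting any vertex. -/
def Nonseparable (G : SimpleGraph V) (S : Set V) : Prop :=
  ∀ X : Set V, X.Subsingleton → G.SetConnected (S \ X)

theorem Nonseparable.setConnected {G : SimpleGraph V} {S : Set V} (h : G.Nonseparable S) :
    G.SetConnected S := by
  simpa using h ∅ Set.subsingleton_empty

theorem Connected.closed_eq_univ {G : SimpleGraph V} (hG : G.Connected) {C : Set V}
    (hne : C.Nonempty) (hC : ∀ c ∈ C, ∀ z, G.Adj c z → z ∈ C) (v : V) : v ∈ C := by
  obtain ⟨c, hc⟩ := hne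
  exact preconnected_iff_forall_prop.1 hG.preconnected (· ∈ C)
    (fun x y h => ⟨fun hx => hC x hx y h, fun hy => hC y hy x h.symm⟩) c v hc

theorem not_isCutVertex_iff [Finite V] {G : SimpleGraph V} (hG : G.Connected) {x : V} :
    ¬ G.IsCutVertex x ↔ (G.induce {x}ᶜ).Preconnected := by
  have h1 : Nat.card G.ConnectedComponent = 1 := by
    have := hG.preconnected.subsingleton_connectedComponent
    have : Nonempty G.ConnectedComponent := ⟨G.connectedComponentMk x⟩
    exact Nat.card_eq_one_iff_unique.2 ⟨inferInstance, inferInstance⟩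
  rw [IsCutVertex, h1, not_lt, Finite.card_le_one_iff_subsingleton]
  refine ⟨fun h a b => ?_, fun h => h.subsingleton_connectedComponent⟩
  exact ConnectedComponent.exact (Subsingleton.elim _ _)

theorem not_isCutVertex_iff_setConnected [Finite V] {G : SimpleGraph V} (hG : G.Connected)
    {x : V} : ¬ G.IsCutVertex x ↔ G.SetConnected {x}ᶜ := by
  rw [not_isCutVertex_iff hG, preconnected_iff_forall_prop]
  constructor
  · intro h f hf a ha b hb hab
    exact h (fun v => f v) (fun y z hyz => hf y y.2 z z.2 hyz) ⟨a, ha⟩ ⟨b, hb⟩ hab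
  · rintro h f hf ⟨a, ha⟩ ⟨b, hb⟩ hab
    obtain ⟨h', hfb⟩ := h (fun v => ∃ hv, f ⟨v, hv⟩)
      (fun y hy z hz hyz => ⟨fun ⟨_, h'⟩ => ⟨hz, (hf ⟨y, hy⟩ ⟨z, hz⟩ hyz).1 h'⟩,
        fun ⟨_, h'⟩ => ⟨hy, (hf ⟨y, hy⟩ ⟨z, hz⟩ hyz).2 h'⟩⟩) a ha b hb ⟨ha, hab⟩
    exact hfb

/-- G has at least the edges of H on these vertices, so a property invariant along G is invariant
along H. -/
theorem nonseparable_of_subgraph [Finite V] {G : SimpleGraph V} {H : G.Subgraph}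
    (hH : H.Connected) (hcut : ∀ x : H.verts, ¬ H.coe.IsCutVertex x) :
    G.Nonseparable H.verts := by
  intro X hX f hf a ha b hb hab
  by_cases hx : ∃ x ∈ X, x ∈ H.verts
  · obtain ⟨x, hxX, hxH⟩ := hx
    have hXx : ∀ y, y ∈ X ↔ y = x := fun y => ⟨fun hy => hX hy hxX, fun h => h ▸ hxX⟩
    have h := (not_isCutVertex_iff_setConnected hH.coe).1 (hcut ⟨x, hxH⟩)
    refine h (fun v => f v) (fun y hy z hz hyz => ?_) ⟨a, ha.1⟩ ?_ ⟨b, hb.1⟩ ?_ hab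
    · exact hf y ⟨y.2, fun h' => hy (Subtype.ext ((hXx y).1 h'))⟩ z
        ⟨z.2, fun h' => hz (Subtype.ext ((hXx z).1 h'))⟩ (Subgraph.Adj.adj_sub hyz)
    · exact fun h' => ha.2 ((hXx a).2 (congrArg Subtype.val h'))
    · exact fun h' => hb.2 ((hXx b).2 (congrArg Subtype.val h'))
  · push Not at hx
    refine preconnected_iff_forall_prop.1 hH.coe.preconnected (fun v => f v)
      (fun y z hyz => ?_) ⟨a, ha.1⟩ ⟨b, hb.1⟩ hab
    exact hf y ⟨y.2, fun h' => hx y h' y.2⟩ z ⟨z.2, fun h' => hx z h' z.2⟩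
      (Subgraph.Adj.adj_sub hyz)

theorem Nonseparable.induce_top [Finite V] {G : SimpleGraph V} {S : Set V} (hS : S.Nonempty)
    (h : G.Nonseparable S) :
    ((⊤ : G.Subgraph).induce S).Connected ∧
      ∀ x, ¬ ((⊤ : G.Subgraph).induce S).coe.IsCutVertex x := by
  have hconn : ((⊤ : G.Subgraph).induce S).Connected := by
    refine ⟨(connected_iff _).2 ⟨preconnected_iff_forall_prop.2 ?_, hS.to_subtype⟩⟩
    rintro f hf ⟨a, ha⟩ ⟨b, hb⟩ hab
    obtain ⟨_, hfb⟩ := h.setConnected (fun v => ∃ hv : v ∈ S, f ⟨v, hv⟩)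
      (fun y hy z hz hyz =>
        have hiff := hf ⟨y, hy⟩ ⟨z, hz⟩ ⟨hy, hz, hyz⟩
        ⟨fun ⟨_, h'⟩ => ⟨hz, hiff.1 h'⟩, fun ⟨_, h'⟩ => ⟨hy, hiff.2 h'⟩⟩) a ha b hb ⟨ha, hab⟩
    exact hfb
  refine ⟨hconn, fun x => (not_isCutVertex_iff_setConnected hconn.coe).2 ?_⟩
  rintro f hf ⟨a, ha⟩ hax ⟨b, hb⟩ hbx hab
  have hne : ∀ y (hy : y ∈ S), y ∉ ({x.1} : Set V) ↔
      (⟨y, hy⟩ : ((⊤ : G.Subgraph).induce S).verts) ∈ ({x}ᶜ : Set _) := by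
    intro y hy
    simp [Subtype.ext_iff]
  obtain ⟨_, hfb⟩ := h {x.1} Set.subsingleton_singleton (fun v => ∃ hv : v ∈ S, f ⟨v, hv⟩)
    (fun y hy z hz hyz =>
      have hiff := hf ⟨y, hy.1⟩ ((hne y hy.1).1 hy.2) ⟨z, hz.1⟩ ((hne z hz.1).1 hz.2)
        ⟨hy.1, hz.1, hyz⟩
      ⟨fun ⟨_, h'⟩ => ⟨hz.1, hiff.1 h'⟩, fun ⟨_, h'⟩ => ⟨hy.1, hiff.2 h'⟩⟩)
    a ⟨ha, (hne a ha).2 hax⟩ b ⟨hb, (hne b hb).2 hbx⟩ ⟨ha, hab⟩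
  exact hfb

theorem Walk.iff_of_support_subset {G : SimpleGraph V} {T : Set V} {f : V → Prop}
    (hf : ∀ a ∈ T, ∀ b ∈ T, G.Adj a b → (f a ↔ f b)) {a b : V} (p : G.Walk a b)
    (hp : ∀ v ∈ p.support, v ∈ T) : f a ↔ f b := by
  induction p with
  | nil => rfl
  | cons h q ih =>
    simp only [Walk.support_cons, List.mem_cons, forall_eq_or_imp] at hp
    exact (hf _ hp.1 _ (hp.2 _ q.start_mem_support) h).trans (ih hp.2)

/-- Attaching an ear to a nonseparable set. -/
theorem Nonseparable.union_support {G : SimpleGraph V} {B : Set V} (hB : G.Nonseparable B)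
    {a b : V} (ha : a ∈ B) (hb : b ∈ B) {q : G.Walk a b} (hq : q.IsPath) :
    G.Nonseparable (B ∪ {v | v ∈ q.support}) := by
  intro X hX f hf
  -- The vertex v cuts the path in two, and a deleted vertex lies on at most one half; the other
  -- half joins v to an end in B.
  have key : ∀ v ∈ (B ∪ {v | v ∈ q.support}) \ X, ∃ c ∈ B \ X, (f v ↔ f c) := by
    rintro v ⟨hv | hv, hvX⟩
    · exact ⟨v, ⟨hv, hvX⟩, Iff.rfl⟩
    · obtain ⟨q₁, q₂, -, -, rfl⟩ := hq.mem_support_iff_exists_append.1 hv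
      by_cases h1 : ∃ x ∈ X, x ∈ q₁.support
      · obtain ⟨x, hxX, hx⟩ := h1
        have h2 : ∀ y ∈ q₂.support, y ∈ (B ∪ {v | v ∈ (q₁.append q₂).support}) \ X := by
          intro y hy
          refine ⟨Or.inr (Walk.mem_support_append_iff _ _ |>.2 (Or.inr hy)), fun hyX => ?_⟩
          obtain rfl := hX hxX hyX
          exact hq.ne_of_mem_support_of_append (fun h => hvX (h ▸ hxX)) hx hy rfl
        exact ⟨b, ⟨hb, (h2 b q₂.end_mem_support).2⟩, q₂.iff_of_support_subset hf h2⟩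
      · push Not at h1
        have h2 : ∀ y ∈ q₁.support, y ∈ (B ∪ {v | v ∈ (q₁.append q₂).support}) \ X :=
          fun y hy => ⟨Or.inr (Walk.mem_support_append_iff _ _ |>.2 (Or.inl hy)),
            fun hyX => h1 y hyX hy⟩
        exact ⟨a, ⟨ha, (h2 a q₁.start_mem_support).2⟩, (q₁.iff_of_support_subset hf h2).symm⟩
  intro v hv w hw hfv
  obtain ⟨c, hc, hvc⟩ := key v hv
  obtain ⟨d, hd, hwd⟩ := key w hw
  exact hwd.2 (hB X hX f (fun x hx y hy => hf x ⟨Or.inl hx.1, hx.2⟩ y ⟨Or.inl hy.1, hy.2⟩)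
    c hc d hd (hvc.1 hfv))

theorem IsBlock.nonseparable [Finite V] {G : SimpleGraph V} {B : G.Subgraph}
    (hB : G.IsBlock B) : G.Nonseparable B.verts :=
  nonseparable_of_subgraph hB.prop.1 hB.prop.2

theorem IsBlock.nonempty {G : SimpleGraph V} {B : G.Subgraph} (hB : G.IsBlock B) :
    B.verts.Nonempty :=
  hB.prop.1.nonempty

theorem IsBlock.subset_verts [Finite V] {G : SimpleGraph V} {B : G.Subgraph}
    (hB : G.IsBlock B) {S : Set V} (hS : G.Nonseparable S) (hBS : B.verts ⊆ S) :
    S ⊆ B.verts := by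
  have hle : B ≤ (⊤ : G.Subgraph).induce S :=
    ⟨hBS, fun a b hab => ⟨hBS hab.fst_mem, hBS hab.snd_mem, hab.adj_sub⟩⟩
  exact (hB.le_of_ge (hS.induce_top (hB.nonempty.mono hBS)) hle).1

theorem IsBlock.nontrivial [Finite V] [Nontrivial V] {G : SimpleGraph V} (hG : G.Connected)
    {B : G.Subgraph} (hB : G.IsBlock B) : B.verts.Nontrivial := by
  obtain ⟨v, hv⟩ := hB.nonempty
  by_contra hn
  have hs : B.verts ⊆ {v} := by
    intro w hw
    by_contra hne
    exact hn ⟨v, hv, w, hw, fun h => hne h.symm⟩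
  obtain ⟨w, hw⟩ := hG.preconnected.exists_adj_of_nontrivial v
  have hS : G.Nonseparable {v, w} := by
    intro X hX f hf a ha b hb hab
    rcases ha with ⟨rfl | rfl, ha⟩ <;> rcases hb with ⟨rfl | rfl, hb⟩
    · exact hab
    · exact (hf _ ⟨Or.inl rfl, ha⟩ _ ⟨Or.inr rfl, hb⟩ hw).1 hab
    · exact (hf _ ⟨Or.inr rfl, ha⟩ _ ⟨Or.inl rfl, hb⟩ hw.symm).1 hab
    · exact hab
  have := hB.subset_verts hS (hs.trans (by simp))
  exact hw.ne (hs (this (Or.inr rfl))).symm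

/-- Since y is not a cut-vertex, z is joined to another vertex of B by a path avoiding y. With the
edge yz this is an ear, which maximality absorbs into B. -/
theorem IsBlock.mem_of_adj [Finite V] [Nontrivial V] {G : SimpleGraph V} (hG : G.Connected)
    {B : G.Subgraph} (hB : G.IsBlock B) {y z : V} (hy : y ∈ B.verts)
    (hcut : ¬ G.IsCutVertex y) (hyz : G.Adj y z) : z ∈ B.verts := by
  classical
  obtain ⟨b, hb, hby⟩ := (hB.nontrivial hG).exists_ne y
  obtain ⟨p⟩ := (not_isCutVertex_iff hG).1 hcut ⟨z, hyz.ne'⟩ ⟨b, hby⟩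
  have hp : ∃ p : G.Walk z b, y ∉ p.support := by
    refine ⟨p.map (Embedding.induce _).toHom, fun h => ?_⟩
    obtain ⟨x, -, hx⟩ := List.mem_map.1
      ((congrArg (y ∈ ·) (Walk.support_map (Embedding.induce {y}ᶜ).toHom p)).mp h)
    exact x.2 hx
  obtain ⟨p, hp⟩ := hp
  have hpath : (Walk.cons hyz p.bypass).IsPath :=
    p.bypass_isPath.cons fun h => hp (p.support_bypass_subset_support h)
  refine hB.subset_verts (hB.nonseparable.union_support hy hb hpath) Set.subset_union_left
    (Or.inr ?_)
  simp

/-! ### Orientations against blocks -/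

theorem two_le_ncard_block_inter [Finite V] [Fintype V] [Nontrivial V] {G : SimpleGraph V}
    (hG : G.Connected) {u : V} {U : Finset V} (hu : u ∈ U)
    (hpot : G.HasPotential u Finset.univ U) {B : G.Subgraph} (hB : G.IsBlock B) :
    2 ≤ (B.verts ∩ (U ∪ G.cutVertices)).ncard := by
  obtain ⟨h, hlow, hup⟩ := hpot
  have hmin : ∀ m ∈ B.verts, (∀ v ∈ B.verts, h m ≤ h v) →
      m ∈ B.verts ∩ (U ∪ G.cutVertices) := by
    intro m hm hle
    by_contra hn
    have hn' : m ∉ U ∧ ¬ G.IsCutVertex m := by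
      simpa [hm, cutVertices] using hn
    obtain ⟨w, -, hadj, hlt⟩ := hlow m (Finset.mem_univ m) (fun h => hn'.1 (h ▸ hu))
    exact absurd (hle w (hB.mem_of_adj hG hm hn'.2 hadj)) (not_le.2 hlt)
  have hmax : ∀ m ∈ B.verts, (∀ v ∈ B.verts, h v ≤ h m) →
      m ∈ B.verts ∩ (U ∪ G.cutVertices) := by
    intro m hm hle
    by_contra hn
    have hn' : m ∉ U ∧ ¬ G.IsCutVertex m := by
      simpa [hm, cutVertices] using hn
    obtain ⟨w, -, hadj, hlt⟩ := hup m (Finset.mem_univ m) hn'.1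
    exact absurd (hle w (hB.mem_of_adj hG hm hn'.2 hadj)) (not_le.2 hlt)
  by_contra! hlt
  have hss : (B.verts ∩ (U ∪ G.cutVertices)).Subsingleton :=
    Set.ncard_le_one_iff_subsingleton.1 (by omega)
  obtain ⟨m, hm, hm'⟩ := Set.exists_min_image B.verts h (Set.toFinite _) hB.nonempty
  obtain ⟨M, hM, hM'⟩ := Set.exists_max_image B.verts h (Set.toFinite _) hB.nonempty
  -- Minimum and maximum coincide, so h is constant on B and any other vertex y is minimal too.
  obtain rfl := hss (hmin m hm hm') (hmax M hM hM')
  obtain ⟨y, hy, hym⟩ := (hB.nontrivial hG).exists_ne m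
  exact hym (hss (hmin y hy fun v hv => (hM' y hy).trans (hm' v hv)) (hmin m hm hm'))

/-- A part `C` avoiding `U` and attached to the rest of `G` at a single vertex contains a
pendant block. -/
theorem exists_block_of_attached [Finite V] {G : SimpleGraph V} (hG : G.Connected) {U : Set V}
    (hU : U.Nonempty) {C : Set V} {w : V} (hne : C.Nonempty) (hw : w ∉ C) (hCU : Disjoint C U)
    (hC : ∀ c ∈ C, ∀ z, G.Adj c z → z ∈ C ∨ z = w) :
    ∃ B : G.Subgraph, G.IsBlock B ∧ (B.verts ∩ (U ∪ G.cutVertices)).ncard = 1 := by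
  induction hn : C.ncard using Nat.strong_induction_on generalizing C w with
  | _ n ih =>
  -- Descend to a part C with no smaller part attached at one vertex; then C together with w is the
  -- block.
  by_cases hsmall : ∃ D ⊆ C, D ≠ C ∧ D.Nonempty ∧ ∃ x ∉ D, ∀ d ∈ D, ∀ z, G.Adj d z →
      z ∈ D ∨ z = x
  · obtain ⟨D, hDC, hne', hD, x, hx, hDx⟩ := hsmall
    exact ih _ (hn ▸ Set.ncard_lt_ncard (hDC.ssubset_of_ne hne')) hD hx
      (hCU.mono_left hDC) hDx rfl
  · have hmin : ∀ (D : Set V) (x : V), D ⊆ C → D.Nonempty → x ∉ D →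
        (∀ d ∈ D, ∀ z, G.Adj d z → z ∈ D ∨ z = x) → D = C := by
      intro D x h1 h2 h3 h4
      by_contra h5
      exact hsmall ⟨D, h1, h5, h2, x, h3, h4⟩
    have hnotclosed : ¬ ∀ c ∈ C, ∀ z, G.Adj c z → z ∈ C := fun h =>
      hw (hG.closed_eq_univ hne h w)
    -- invariants are constant on `insert w C` minus a vertex
    have hconst : ∀ (X : Set V), X.Subsingleton → w ∉ X → ∀ f : V → Prop,
        (∀ a ∈ insert w C \ X, ∀ b ∈ insert w C \ X, G.Adj a b → (f a ↔ f b)) →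
        ∀ c ∈ insert w C \ X, (f c ↔ f w) := by
      intro X hX hwX f hf c hc
      by_contra hfc
      have hcw : c ≠ w := by
        rintro rfl
        exact hfc Iff.rfl
      -- D can be left only through X. If some x ∈ X lies in C, minimality gives D = C, although x ∉
      -- D; otherwise D is closed under adjacency, although w ∉ D.
      set D : Set V := {d | d ∈ C ∧ d ∉ X ∧ ¬ (f d ↔ f w)} with hD
      have hcD : c ∈ D := ⟨hc.1.resolve_left hcw, hc.2, hfc⟩
      have hstep : ∀ d ∈ D, ∀ z, G.Adj d z → z ∈ D ∨ z ∈ X ∩ C := by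
        intro d hd z hdz
        have hz : z ∈ insert w C := (hC d hd.1 z hdz).symm
        by_cases hzX : z ∈ X
        · refine Or.inr ⟨hzX, hz.resolve_left ?_⟩
          rintro rfl
          exact hwX hzX
        · have hiff := hf d ⟨Or.inr hd.1, hd.2.1⟩ z ⟨hz, hzX⟩ hdz
          refine Or.inl ⟨hz.resolve_left ?_, hzX, fun h => hd.2.2 (hiff.trans h)⟩
          rintro rfl
          exact hd.2.2 hiff
      by_cases hx : (X ∩ C).Nonempty
      · obtain ⟨x, hxX, hxC⟩ := hx
        have hxD : x ∉ D := fun h => h.2.1 hxX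
        have := hmin D x (fun d hd => hd.1) ⟨c, hcD⟩ hxD fun d hd z hdz =>
          (hstep d hd z hdz).imp id fun h => hX h.1 hxX
        exact hxD (this ▸ hxC)
      · rw [Set.not_nonempty_iff_eq_empty] at hx
        have hwD := hG.closed_eq_univ ⟨c, hcD⟩ (fun d hd z hdz =>
          (hstep d hd z hdz).resolve_right (by simp [hx])) w
        exact hw hwD.1
    have hns : G.Nonseparable (insert w C) := by
      intro X hX f hf a ha b hb hab
      by_cases hwX : w ∈ X
      · have hXw : ∀ y ∈ X, y = w := fun y hy => hX hy hwX
        have haw : a ∈ C := ha.1.resolve_left fun h => ha.2 (h ▸ hwX)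
        have hbw : b ∈ C := hb.1.resolve_left fun h => hb.2 (h ▸ hwX)
        have hCX : ∀ c ∈ C, c ∈ insert w C \ X := fun c hc =>
          ⟨Or.inr hc, fun h => hw (hXw c h ▸ hc)⟩
        have := hmin {d | d ∈ C ∧ f d} w (fun d hd => hd.1) ⟨a, haw, hab⟩ (fun h => hw h.1)
          (fun d hd z hdz => (hC d hd.1 z hdz).imp
            (fun hz => ⟨hz, (hf d (hCX d hd.1) z (hCX z hz) hdz).1 hd.2⟩) id)
        exact (this.symm ▸ hbw : b ∈ {d | d ∈ C ∧ f d}).2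
      · exact (hconst X hX hwX f hf b hb).2 ((hconst X hX hwX f hf a ha).1 hab)
    have hblock : G.IsBlock ((⊤ : G.Subgraph).induce (insert w C)) := by
      refine ⟨hns.induce_top (Set.insert_nonempty w C), ?_⟩
      rintro H ⟨hH, hHcut⟩ hle
      have hHn := nonseparable_of_subgraph hH hHcut
      have hsub : H.verts ⊆ insert w C := by
        intro z hz
        by_contra hzn
        have hzw : z ≠ w := fun h => hzn (Or.inl h)
        obtain ⟨c, hc⟩ := hne
        -- Away from w, membership in C is invariant, so a nonseparable H cannot leave C.
        refine hzn (Or.inr (hHn {w} Set.subsingleton_singleton (· ∈ C) ?_ c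
          ⟨hle.1 (Or.inr hc), fun h => hw (h ▸ hc)⟩ z ⟨hz, hzw⟩ hc))
        intro a ha b hb hab
        exact ⟨fun h => (hC a h b hab).resolve_right hb.2,
          fun h => (hC b h a hab.symm).resolve_right ha.2⟩
      exact ⟨hsub, fun a b hab => ⟨hsub hab.fst_mem, hsub hab.snd_mem, hab.adj_sub⟩⟩
    refine ⟨_, hblock, Set.ncard_eq_one.2 ⟨w, ?_⟩⟩
    have hverts : ((⊤ : G.Subgraph).induce (insert w C)).verts = insert w C := rfl
    rw [hverts]
    ext v
    simp only [Set.mem_inter_iff, Set.mem_singleton_iff]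
    constructor
    · rintro ⟨hv, hv'⟩
      by_contra hvw
      have hvC : v ∈ C := hv.resolve_left hvw
      have hcut : G.IsCutVertex v := hv'.resolve_left (Set.disjoint_left.1 hCU hvC)
      -- Deleting v leaves the rest of `insert w C` tied to w, and vertices disagreeing with w would
      -- form a closed set, as all neighbours of v are in `insert w C`.
      refine (not_isCutVertex_iff_setConnected hG).2 ?_ hcut
      intro f hf
      have hwv : w ≠ v := Ne.symm hvw
      have hin : ∀ c ∈ insert w C \ {v}, (f c ↔ f w) :=
        hconst {v} Set.subsingleton_singleton hwv f
          (fun a ha b hb hab => hf a ha.2 b hb.2 hab)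
      have hall : ∀ y, y ≠ v → (f y ↔ f w) := by
        intro y hy
        by_contra hfy
        have hout : ∀ d, d ≠ v → ¬ (f d ↔ f w) → d ∉ insert w C := fun d hd h hd' =>
          h (hin d ⟨hd', hd⟩)
        refine (hG.closed_eq_univ (C := {d | d ≠ v ∧ ¬ (f d ↔ f w)}) ⟨y, hy, hfy⟩
          (fun d hd z hdz => ?_) w).2 Iff.rfl
        have hzv : z ≠ v := by
          rintro rfl
          exact hout d hd.1 hd.2 (hC z hvC d hdz.symm).symm
        exact ⟨hzv, fun h => hd.2 ((hf d hd.1 z hzv hdz).trans h)⟩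
      intro a ha b hb hab
      exact (hall b hb).2 ((hall a ha).1 hab)
    · rintro rfl
      refine ⟨Or.inl rfl, ?_⟩
      by_cases hvU : v ∈ U
      · exact Or.inl hvU
      · refine Or.inr ?_
        by_contra hcut
        obtain ⟨c, hc⟩ := hne
        obtain ⟨x, hx⟩ := hU
        -- Otherwise membership in C would spread, avoiding w, to a point of U.
        refine Set.disjoint_left.1 hCU ((not_isCutVertex_iff_setConnected hG).1 hcut (· ∈ C) ?_
          c (fun h => hw (h ▸ hc)) x (fun h => hvU (h ▸ hx)) hc) hx
        intro a ha b hb hab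
        exact ⟨fun h => (hC a h b hab).resolve_right hb,
          fun h => (hC b h a hab.symm).resolve_right ha⟩

/-! ### Growing a potential by ears -/

/-- `h` witnesses `HasPotential` on a vertex set `W` containing `u`, and is injective there. -/
structure IsPotentialOn (G : SimpleGraph V) (u : V) (W U : Finset V) (h : V → ℚ) : Prop where
  root_mem : u ∈ W
  injOn : Set.InjOn h W
  lower : ∀ v ∈ W, v ≠ u → ∃ w ∈ W, G.Adj v w ∧ h w < h v
  upper : ∀ v ∈ W, v ∉ U → ∃ w ∈ W, G.Adj v w ∧ h v < h w

theorem IsPotentialOn.mono {G : SimpleGraph V} {u : V} {W U U' : Finset V} {h : V → ℚ}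
    (hh : G.IsPotentialOn u W U h) (hU : U ⊆ U') : G.IsPotentialOn u W U' h :=
  ⟨hh.root_mem, hh.injOn, hh.lower, fun v hv hvU => hh.upper v hv fun h' => hvU (hU h')⟩

/-- Place a new vertex `c` above its neighbour `d`, at a new height. -/
theorem IsPotentialOn.insert_update [DecidableEq V] {G : SimpleGraph V} {u c d : V}
    {W U : Finset V} {h : V → ℚ} {β : ℚ} (hh : G.IsPotentialOn u W (insert d U) h) (hd : d ∈ W) (hc : c ∉ W)
    (hdc : G.Adj d c) (hβ : h d < β) (hβW : β ∉ W.image h) :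
    G.IsPotentialOn u (insert c W) (insert c U) (Function.update h c β) := by
  have hold : ∀ v ∈ W, Function.update h c β v = h v := fun v hv =>
    Function.update_of_ne (ne_of_mem_of_not_mem hv hc) _ _
  have hnew : Function.update h c β c = β := Function.update_self c β h
  have hne : ∀ v ∈ W, h v ≠ β := fun v hv h' => hβW (Finset.mem_image.2 ⟨v, hv, h'⟩)
  refine ⟨Finset.mem_insert_of_mem hh.root_mem, ?_, fun v hv hvu => ?_, fun v hv hvU => ?_⟩
  · intro a ha b hb hab
    rcases Finset.mem_insert.1 ha with rfl | ha' <;> rcases Finset.mem_insert.1 hb with rfl | hb'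
    · rfl
    · rw [hnew, hold b hb'] at hab
      exact absurd hab.symm (hne b hb')
    · rw [hnew, hold a ha'] at hab
      exact absurd hab (hne a ha')
    · rw [hold a ha', hold b hb'] at hab
      exact hh.injOn ha' hb' hab
  · rcases Finset.mem_insert.1 hv with rfl | hv
    · exact ⟨d, Finset.mem_insert_of_mem hd, hdc.symm, by rwa [hnew, hold d hd]⟩
    · obtain ⟨w, hw, hadj, hlt⟩ := hh.lower v hv hvu
      exact ⟨w, Finset.mem_insert_of_mem hw, hadj, by rwa [hold v hv, hold w hw]⟩
  · simp only [Finset.mem_insert, not_or] at hvU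
    have hv := (Finset.mem_insert.1 hv).resolve_left hvU.1
    by_cases hvd : v = d
    · subst hvd
      exact ⟨c, Finset.mem_insert_self c W, hdc, by rwa [hnew, hold v hv]⟩
    · obtain ⟨w, hw, hadj, hlt⟩ := hh.upper v hv (by simp [hvd, hvU.2])
      exact ⟨w, Finset.mem_insert_of_mem hw, hadj, by rwa [hold v hv, hold w hw]⟩

/-- Extend a potential along a path that leaves `W` and ends in `U` or at a higher vertex
of `W`. -/
theorem IsPotentialOn.exists_extend [DecidableEq V] {G : SimpleGraph V} {u d t : V} {U : Finset V}
    (p : G.Walk d t) : ∀ {W : Finset V} {h : V → ℚ}, p.IsPath → d ≠ t → d ∈ W →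
      G.IsPotentialOn u W (insert d U) h → (∀ v ∈ p.support, v ∈ W → v = d ∨ v = t) →
      (t ∈ U ∨ t ∈ W) → (t ∈ W → h d < h t) →
      ∃ W' h', W ⊆ W' ∧ G.IsPotentialOn u W' U h' ∧ ∀ v ∈ p.support, v ∈ W' := by
  induction p with
  | nil => exact fun _ h => absurd rfl h
  | @cons d c t hdc q ih =>
    intro W h hp hdt hd hh hW htU hlt
    obtain ⟨hq, hdq⟩ := (Walk.cons_isPath_iff _ _).1 hp
    by_cases hcW : c ∈ W
    · obtain rfl : c = t := (hW c (by simp) hcW).resolve_left hdc.ne'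
      have hqs : q.support = [c] := Walk.nil_iff_support_eq.1 (Walk.isPath_iff_nil.1 hq)
      refine ⟨W, h, subset_rfl, ⟨hh.root_mem, hh.injOn, hh.lower, fun v hv hvU => ?_⟩, ?_⟩
      · by_cases hvd : v = d
        · subst hvd
          exact ⟨c, hcW, hdc, hlt hcW⟩
        · exact hh.upper v hv (by simp [hvd, hvU])
      · simp [hqs, hd, hcW]
    · have hgap : h d < if t ∈ W then h t else h d + 1 := by
        split_ifs with ht
        · exact hlt ht
        · linarith
      obtain ⟨β, hβ, hβW⟩ := (Set.Ioo_infinite hgap).exists_notMem_finset (W.image h)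
      -- The licence to be a sink passes from d to the new tip c.
      have hext := hh.insert_update hd hcW hdc hβ.1 hβW
      by_cases hct : c = t
      · subst hct
        have hqs : q.support = [c] := Walk.nil_iff_support_eq.1 (Walk.isPath_iff_nil.1 hq)
        rw [Finset.insert_eq_of_mem (htU.resolve_right hcW)] at hext
        exact ⟨_, _, Finset.subset_insert c W, hext, by simp [hqs, hd]⟩
      · obtain ⟨W', h', hWW', hh', hsup⟩ := ih (W := insert c W) hq hct
          (Finset.mem_insert_self c W) hext (fun v hv hvW => by
            rcases Finset.mem_insert.1 hvW with hvc | hvW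
            · exact Or.inl hvc
            · refine Or.inr ((hW v (by simp [hv]) hvW).resolve_left ?_)
              rintro rfl
              exact hdq hv) (htU.imp id (Finset.mem_insert_of_mem ·)) (fun ht => by
            have ht := (Finset.mem_insert.1 ht).resolve_left (Ne.symm hct)
            rw [Function.update_self, Function.update_of_ne (Ne.symm hct)]
            simpa [ht] using hβ.2)
        have hWW := (Finset.insert_subset_iff.1 hWW')
        exact ⟨W', h', hWW.2, hh', by simpa [hWW.2 hd] using hsup⟩

theorem hasPotential_or_exists_block [Fintype V] {G : SimpleGraph V} (hG : G.Connected) {u : V}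
    {U : Finset V} (hu : u ∈ U) :
    G.HasPotential u Finset.univ U ∨
      ∃ B : G.Subgraph, G.IsBlock B ∧ (B.verts ∩ (U ∪ G.cutVertices)).ncard = 1 := by
  classical
  have hstart : G.IsPotentialOn u {u} U fun _ => 0 :=
    ⟨Finset.mem_singleton_self u, by simp, by simp, by simp [hu]⟩
  obtain ⟨W, hWh, hmax⟩ := Finset.exists_max_image
    (Finset.univ.filter fun W => ∃ h, G.IsPotentialOn u W U h) Finset.card
    ⟨{u}, by simpa using ⟨_, hstart⟩⟩
  obtain ⟨h, hh⟩ := (Finset.mem_filter.1 hWh).2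
  -- Maximality of W: every admissible ear already lies in W.
  have hstuck : ∀ {d t : V} (p : G.Walk d t), p.IsPath → d ≠ t → d ∈ W →
      (∀ v ∈ p.support, v ∈ W → v = d ∨ v = t) → (t ∈ U ∨ t ∈ W) → (t ∈ W → h d < h t) →
      ∀ v ∈ p.support, v ∈ W := by
    intro d t p hp hdt hd hW htU hlt v hv
    obtain ⟨W', h', hWW', hh', hsup⟩ := IsPotentialOn.exists_extend p hp hdt hd
      (hh.mono (Finset.subset_insert d U)) hW htU hlt
    have hle := hmax W' (by simpa using ⟨h', hh'⟩)
    rw [Finset.eq_of_subset_of_card_le hWW' hle]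
    exact hsup v hv
  by_cases hWuniv : W = Finset.univ
  · subst hWuniv
    exact Or.inl ⟨h, hh.lower, hh.upper⟩
  · right
    obtain ⟨w, hw, x, hx, hwx⟩ : ∃ w ∈ W, ∃ x ∉ W, G.Adj w x := by
      by_contra! hclosed
      refine hWuniv (Finset.eq_univ_iff_forall.2 fun v => ?_)
      exact hG.closed_eq_univ (C := (W : Set V)) ⟨u, hh.root_mem⟩ (fun c hc z hcz => by
        by_contra hz
        exact hclosed c hc z hz hcz) v
    set C : Set V := {y | ∃ p : G.Walk x y, ∀ v ∈ p.support, v ∉ W} with hC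
    have hxC : x ∈ C := ⟨Walk.nil, by simpa using hx⟩
    have hCW : ∀ y ∈ C, y ∉ W := fun y ⟨p, hp⟩ => hp y p.end_mem_support
    have hCU : Disjoint C (U : Set V) := by
      refine Set.disjoint_left.2 fun y hy hyU => ?_
      obtain ⟨p, hp⟩ := id hy
      have hp' : ∀ v ∈ p.bypass.support, v ∉ W := fun v hv =>
        hp v (p.support_bypass_subset_support hv)
      refine hx (hstuck (Walk.cons hwx p.bypass)
        (p.bypass_isPath.cons fun h' => hp' w h' hw) ?_ hw ?_ (Or.inl hyU)
        (fun h' => absurd h' (hCW y hy)) x (by simp))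
      · rintro rfl
        exact hCW w hy hw
      · intro v hv hvW
        rw [Walk.support_cons, List.mem_cons] at hv
        exact Or.inl (hv.resolve_right fun h' => hp' v h' hvW)
    -- Attachment vertices of different heights would be joined by an ear through C.
    have hlt : ∀ w₁ ∈ W, ∀ w₂ ∈ W, ∀ y₁ ∈ C, ∀ y₂ ∈ C, G.Adj w₁ y₁ → G.Adj y₂ w₂ →
        ¬ h w₁ < h w₂ := by
      rintro w₁ hw₁ w₂ hw₂ y₁ ⟨p₁, hp₁⟩ y₂ ⟨p₂, hp₂⟩ h₁ h₂ hlt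
      have hp : ∀ v ∈ (p₁.reverse.append p₂).bypass.support, v ∉ W := by
        intro v hv
        have := (p₁.reverse.append p₂).support_bypass_subset_support hv
        rw [Walk.mem_support_append_iff, Walk.support_reverse, List.mem_reverse] at this
        exact this.elim (hp₁ v) (hp₂ v)
      have hpath := (p₁.reverse.append p₂).bypass_isPath
      generalize (p₁.reverse.append p₂).bypass = p at hp hpath
      have hne : w₁ ≠ w₂ := by
        rintro rfl
        exact lt_irrefl _ hlt
      refine hp y₁ p.start_mem_support (hstuck (Walk.cons h₁ (p.concat h₂))
        ((hpath.concat (fun h' => hp w₂ h' hw₂) h₂).cons ?_) hne hw₁ ?_ (Or.inr hw₂)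
        (fun _ => hlt) y₁ (by simp))
      · rw [Walk.support_concat, List.mem_append, List.mem_singleton]
        rintro (h' | h')
        · exact hp w₁ h' hw₁
        · exact hne h'
      · intro v hv hvW
        rw [Walk.support_cons, List.mem_cons, Walk.support_concat, List.mem_append,
          List.mem_singleton] at hv
        rcases hv with hv | hv | hv
        · exact Or.inl hv
        · exact absurd hvW (hp v hv)
        · exact Or.inr hv
    refine exists_block_of_attached hG ⟨u, hu⟩ ⟨x, hxC⟩ (fun h' => hCW w h' hw) hCU ?_
    intro c hc z hcz
    by_cases hz : z ∈ W
    · right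
      -- Attachment vertices have equal heights; injectivity makes them a single vertex.
      refine hh.injOn hz hw (le_antisymm ?_ ?_)
      · exact not_lt.1 (hlt w hw z hz x hxC c hc hwx hcz)
      · exact not_lt.1 (hlt z hz w hw c hc x hxC hcz.symm hwx.symm)
    · left
      obtain ⟨p, hp⟩ := hc
      refine ⟨p.concat hcz, fun v hv => ?_⟩
      rw [Walk.support_concat, List.mem_append, List.mem_singleton] at hv
      rcases hv with hv | rfl
      · exact hp v hv
      · exact hz

end SimpleGraph

theorem proposition7p8 {V : Type*} [Finite V] [Nontrivial V] (G : SimpleGraph V)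
    (hG : G.Connected) (U : Set V) (hU : U.Nonempty) :
    ((G.nucleusComplex hG U).reducedEulerChar = 0 ↔
      ∃ B : G.Subgraph, G.IsBlock B ∧ (B.verts ∩ (U ∪ G.cutVertices)).ncard = 1) ∧
    ((G.nucleusComplex hG U).reducedEulerChar ≠ 0 ↔
      ∀ B : G.Subgraph, G.IsBlock B → 2 ≤ (B.verts ∩ (U ∪ G.cutVertices)).ncard) := by
  classical
  have := Fintype.ofFinite V
  obtain ⟨U, rfl⟩ : ∃ U' : Finset V, (U' : Set V) = U := ⟨U.toFinset, Set.coe_toFinset U⟩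
  obtain ⟨u, hu⟩ := hU
  have hpot := SimpleGraph.reducedEulerChar_nucleusComplex_ne_zero_iff hG hu
  have h2 : (G.nucleusComplex hG U).reducedEulerChar ≠ 0 →
      ∀ B : G.Subgraph, G.IsBlock B → 2 ≤ (B.verts ∩ (U ∪ G.cutVertices)).ncard :=
    fun h B hB => SimpleGraph.two_le_ncard_block_inter hG hu (hpot.1 h) hB
  have h1 : (G.nucleusComplex hG U).reducedEulerChar = 0 →
      ∃ B : G.Subgraph, G.IsBlock B ∧ (B.verts ∩ (U ∪ G.cutVertices)).ncard = 1 := fun h =>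
    (SimpleGraph.hasPotential_or_exists_block hG hu).resolve_left fun h' => hpot.2 h' h
  -- Since the counts 1 and ≥ 2 exclude each other, `h1` and `h2` yield both equivalences.
  refine ⟨⟨h1, fun ⟨B, hB, hB1⟩ => ?_⟩, h2, fun h h0 => ?_⟩
  · by_contra hne
    have := h2 hne B hB
    omega
  · obtain ⟨B, hB, hB1⟩ := h1 h0
    have := h B hB
    omega
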